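/- Semirings are associative with $0$ and $1$, with $0s=0=s0$; they need not be commutative. A semiring $S$ is a right CP-semiring if every cyclic right $S$-semimodule (homomorphic image of $S_S$) is projective (a retract of a free right $S$-semimodule). $S$ is ideal-simple if its only two-sided ideals are $0$ and $S$, congruence-simple if its only congruences are the diagonal and the universal one, and simple if it is both ideal-simple and congruence-simple. A nonempty finite distributive lattice $M$ is regarded as the commutative monoid $(M,\vee,0)$, where $0$ is its least element; $\mathrm{End}(M)$ is the semiring of its endomorphisms (pointwise join, composition) and $\mathrm{Cong}(M)$ is the set of its congruences as a commutative monoid. Let $T(M)=\{m\in M : \text{every } x\in M \text{ satisfies } x\le m \text{ or } m\le x\}$. Consider the conditions (a) $\mathrm{End}(M)$ is a right CP-semiring; (b) for every $\theta\in\mathrm{Cong}(M)$, the quotient semilattice $M/\theta$ is a distributive lattice; (c) whenever $t\le t'$ are in $T(M)$ and $[t,t']\cap T(M)=\{t,t'\}$, either $[t,t']=\{t,t'\}$ or $[t,t']$ is isomorphic to the four-element Boolean lattice $\mathbf B^2$. **Theorem.** For a semiring $S$ the following are equivalent: (1) $S$ is an ideal-simple right CP-semiring; (2) $S$ is a simple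 right CP-semiring; (3a) $S\cong M_n(D)$ for some division ring $D$ and $n\ge 1$, or $S\cong\mathrm{End}(M)$ for some finite distributive lattice $M$ satisfying (a); (3b) the same as (3a), with (b) in place of (a); (3c) the same as (3a), with (c) in place of (a). -/

import Mathlib

universe u

/-- Every two-sided ideal of the semiring `S` is `0` or `S`. Elements of `Ideal S` are left ideals,
`Ideal.IsTwoSided` adds closure under multiplication on the right. -/
def IsIdealSimple (S : Type u) [Semiring S] : Prop :=
  ∀ I : Ideal S, I.IsTwoSided → I = ⊥ ∨ I = ⊤

/-- Every congruence of the semiring `S` is the diagonal `⊥` or the universal one `⊤`. -/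
def IsCongruenceSimple (S : Type u) [Semiring S] : Prop :=
  ∀ c : RingCon S, c = ⊥ ∨ c = ⊤

/-- A semiring is simple if it is both congruence-simple and ideal-simple. -/
def IsSimpleSemiring (S : Type u) [Semiring S] : Prop :=
  IsCongruenceSimple S ∧ IsIdealSimple S

/-- Right `S`-semimodules are modules over `Sᵐᵒᵖ`. A right `S`-semimodule is cyclic if it is a
homomorphic image of the regular right semimodule `S`. -/
def IsCyclicRight (S : Type u) [Semiring S] (A : Type u) [AddCommMonoid A] [Module Sᵐᵒᵖ A] :
    Prop :=
  ∃ f : S →ₗ[Sᵐᵒᵖ] A, Function.Surjective f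

/-- `S` is a right CP-semiring if all cyclic right `S`-semimodules are projective, that is,
retracts of free right semimodules. -/
def IsRightCP (S : Type u) [Semiring S] : Prop :=
  ∀ (A : Type u) [AddCommMonoid A] [Module Sᵐᵒᵖ A],
    IsCyclicRight S A → Module.Projective Sᵐᵒᵖ A

/-- The set `M`, to be considered as the commutative monoid `(M, ⊔, ⊥)`, equivalently as a
semimodule over the two-element Boolean semiring. -/
def JoinMonoid (M : Type u) : Type u := M

instance JoinMonoid.instZero (M : Type u) [SemilatticeSup M] [OrderBot M] :
    Zero (JoinMonoid M) :=
  ⟨(⊥ : M)⟩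

instance JoinMonoid.instAdd (M : Type u) [SemilatticeSup M] [OrderBot M] :
    Add (JoinMonoid M) :=
  ⟨fun a b => ((a : M) ⊔ (b : M) : M)⟩

instance JoinMonoid.instAddCommMonoid (M : Type u) [SemilatticeSup M] [OrderBot M] :
    AddCommMonoid (JoinMonoid M) where
  add_assoc a b c := sup_assoc (α := M) a b c
  zero_add a := bot_sup_eq (α := M) a
  add_zero a := sup_bot_eq (α := M) a
  add_comm a b := sup_comm (α := M) a b
  nsmul := nsmulRec

/-- The endomorphism semiring `End(M)` of a join-semilattice with least element: all self-maps
preserving `⊔` and `⊥`, with pointwise join as addition and composition as multiplication. -/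
abbrev EndLattice (M : Type u) [SemilatticeSup M] [OrderBot M] : Type u :=
  AddMonoid.End (JoinMonoid M)

/-- For each congruence `θ` of the semilattice `(M, ⊔, ⊥)`, the quotient semilattice `M/θ` is a
distributive lattice, i.e. its join operation (which determines its order) is the join operation
of a distributive lattice. -/
def QuotientsDistributive (M : Type u) [SemilatticeSup M] [OrderBot M] : Prop :=
  ∀ θ : AddCon (JoinMonoid M),
    ∃ L : DistribLattice θ.Quotient, ∀ x y : θ.Quotient, L.sup x y = x + y

/-- `T(M)`: the elements of `M` that are comparable with all elements. -/
def comparableSet (M : Type u) [LE M] : Set M :=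
  {m | ∀ x : M, x ≤ m ∨ m ≤ x}

/-- If `t ≤ t'` are in `T(M)` and no element of `T(M)` lies strictly between them, then either
no element of `M` lies strictly between them, or the interval `[t, t']` is isomorphic to the
four-element Boolean lattice. -/
def IntervalCondition (M : Type u) [Lattice M] : Prop :=
  ∀ t ∈ comparableSet M, ∀ t' ∈ comparableSet M, t ≤ t' →
    Set.Icc t t' ∩ comparableSet M = {t, t'} →
      Set.Icc t t' = {t, t'} ∨ Nonempty (Set.Icc t t' ≃o Bool × Bool)

/-- `S` is isomorphic to the semiring of `n × n` matrices, `n ≥ 1`, over a division ring. -/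
def IsMatrixOverDivisionRing (S : Type u) [Semiring S] : Prop :=
  ∃ (n : ℕ) (D : Type u) (_ : DivisionRing D),
    1 ≤ n ∧ Nonempty (S ≃+* Matrix (Fin n) (Fin n) D)

/-! A cyclic right semimodule is projective exactly when the right congruence defining it is the
kernel of left multiplication by an idempotent (`isRightCP_iff`). So the CP condition turns every
right congruence that one can write down into an idempotent.

Let S be nonzero, ideal-simple and right CP. The elements with a negative form a two-sided ideal, so
S is either a ring, where CP means semisimple and Wedderburn–Artin applies, or zerosumfree. In the
second case one right congruence forces addition to be idempotent
(`IsIdealSimple.add_self_of_zerosumfree`), and another, built from a maximal right ideal of a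
suitable kind, gives e ≠ 0 with eSe = {0, e} (`IsRightCP.exists_primitive_idempotent`). Since SeS =
S, S is then the full endomorphism semiring of the additive monoid Se
(`IsIdealSimple.exists_ringEquiv_end`).

`HasPrimeDecomposition` says that a monoid is a retract of a finite power of the Boolean semiring;
such monoids are precisely the finite distributive lattices. It provides enough rank-one
endomorphisms to make the endomorphism semiring simple and to match its right congruences with the
congruences of the lattice, which gives (a) ↔ (b). For finite lattices, (b) and (c) are both
equivalent to the elementary condition `IncomparablePairsIsolated`. -/

/-! ### Right congruences, idempotents and transport along isomorphisms -/

/-- The quotient of `S` by a right congruence, as a right semimodule. -/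
@[reducible] def AddCon.rightModule {S : Type u} [Semiring S] (c : AddCon S)
    (hc : ∀ a b s, c a b → c (a * s) (b * s)) : Module Sᵐᵒᵖ c.Quotient where
  smul s := Quotient.map' (· * s.unop) fun a b h => hc a b s.unop h
  one_smul := by
    rintro ⟨a⟩; exact congrArg (Quotient.mk'' : S → c.Quotient) (mul_one a)
  mul_smul := by
    rintro s t ⟨a⟩
    exact congrArg (Quotient.mk'' : S → c.Quotient) (mul_assoc a t.unop s.unop).symm
  smul_zero s := congrArg (Quotient.mk'' : S → c.Quotient) (zero_mul s.unop)
  smul_add := by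
    rintro s ⟨a⟩ ⟨b⟩; exact congrArg (Quotient.mk'' : S → c.Quotient) (add_mul a b s.unop)
  add_smul := by
    rintro s t ⟨a⟩; exact congrArg (Quotient.mk'' : S → c.Quotient) (mul_add a s.unop t.unop)
  zero_smul := by
    rintro ⟨a⟩; exact congrArg (Quotient.mk'' : S → c.Quotient) (mul_zero a)

/-- A semiring is right CP iff every right congruence is the kernel of left multiplication by an
idempotent. -/
theorem isRightCP_iff {S : Type u} [Semiring S] :
    IsRightCP S ↔ ∀ c : AddCon S, (∀ a b s, c a b → c (a * s) (b * s)) →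
      ∃ e : S, e * e = e ∧ ∀ a b, c a b ↔ e * a = e * b := by
  constructor
  · intro h c hc
    let _ := c.rightModule hc
    let f : S →ₗ[Sᵐᵒᵖ] c.Quotient :=
      { toFun := fun a => (a : c.Quotient), map_add' := fun _ _ => rfl, map_smul' := fun _ _ => rfl }
    have hf : Function.Surjective f := by rintro ⟨a⟩; exact ⟨a, rfl⟩
    have := h c.Quotient ⟨f, hf⟩
    obtain ⟨g, hg⟩ := Module.projective_lifting_property f LinearMap.id hf
    have hfg : ∀ q, f (g q) = q := fun q => LinearMap.congr_fun hg q
    -- By right linearity, the composite of `f` with its section is left multiplication by the image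
    -- of 1, which is the required idempotent.
    have hgf : ∀ a, g (f a) = g (f 1) * a := fun a => by
      have h1 : f a = MulOpposite.op a • f 1 := by rw [← map_smul]; simp
      rw [h1, map_smul]; rfl
    refine ⟨g (f 1), ?_, fun a b => ?_⟩
    · rw [← hgf, hfg]
    · rw [← hgf, ← hgf]
      refine ⟨fun hab => congrArg g ((AddCon.eq c).2 hab), fun hab => (AddCon.eq c).1 ?_⟩
      have := congrArg f hab
      rwa [hfg, hfg] at this
  · intro h A _ _ ⟨f, hf⟩
    obtain ⟨e, he, hc⟩ := h (AddCon.ker f) fun a b s hab => by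
      have h1 : ∀ x : S, f (x * s) = MulOpposite.op s • f x := fun x => by rw [← map_smul]; rfl
      change f _ = f _
      rw [h1, h1, show f a = f b from hab]
    have hc' : ∀ a b, f a = f b → e * a = e * b := fun a b => (hc a b).1
    have hs := Function.surjInv_eq hf
    -- Multiplication by `e` erases the dependence on the chosen preimage, so this set-theoretic
    -- section becomes linear.
    let g : A →ₗ[Sᵐᵒᵖ] S :=
      { toFun := fun y => e * Function.surjInv hf y
        map_add' := fun x y => by
          rw [← mul_add]; apply hc'; rw [map_add, hs, hs, hs]
        map_smul' := fun s y => by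
          change _ = e * _ * s.unop
          rw [mul_assoc]
          apply hc'
          rw [hs, show Function.surjInv hf y * s.unop = s • Function.surjInv hf y from rfl, map_smul,
            hs] }
    have : Module.Projective Sᵐᵒᵖ S :=
      Module.Projective.of_equiv (MulOpposite.opLinearEquiv Sᵐᵒᵖ : S ≃ₗ[Sᵐᵒᵖ] Sᵐᵒᵖ).symm
    refine Module.Projective.of_split g f (LinearMap.ext fun y => ?_)
    change f (e * Function.surjInv hf y) = y
    rw [← show f (Function.surjInv hf y) = y from hs y]
    have : f (e * Function.surjInv hf y) = f (Function.surjInv hf y) :=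
      (hc _ _).2 (by rw [← mul_assoc, he])
    rw [hs y] at this ⊢
    exact this

theorem IsRightCP.of_ringEquiv {S T : Type u} [Semiring S] [Semiring T] (φ : S ≃+* T)
    (h : IsRightCP T) : IsRightCP S := by
  rw [isRightCP_iff] at h ⊢
  intro c hc
  obtain ⟨e, he, hce⟩ := h (c.comap φ.symm (map_add φ.symm)) fun a b s hab => by
    simpa [AddCon.comap_rel] using hc _ _ (φ.symm s) hab
  refine ⟨φ.symm e, by rw [← map_mul, he], fun a b => ?_⟩
  have := hce (φ a) (φ b)
  rw [AddCon.comap_rel, φ.symm_apply_apply, φ.symm_apply_apply] at this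
  rw [this, ← φ.injective.eq_iff, map_mul, map_mul, φ.apply_symm_apply]

theorem IsCongruenceSimple.of_ringEquiv {S T : Type u} [Semiring S] [Semiring T] (φ : S ≃+* T)
    (h : IsCongruenceSimple T) : IsCongruenceSimple S := by
  intro c
  have hc : ∀ a b, c a b ↔ c.comap φ.symm (φ a) (φ b) := fun a b => by simp [RingCon.comap_rel]
  rcases h (c.comap φ.symm) with h | h
  · left
    ext a b
    rw [hc, h]
    simp
  · right
    ext a b
    rw [hc, h]
    simp

theorem IsIdealSimple.of_ringEquiv {S T : Type u} [Semiring S] [Semiring T] (φ : S ≃+* T)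
    (h : IsIdealSimple T) : IsIdealSimple S := by
  intro I hI
  have hmem : ∀ a, a ∈ I ↔ φ a ∈ I.comap φ.symm := fun a => by simp
  rcases h (I.comap φ.symm) inferInstance with h | h
  · left
    ext a
    rw [hmem, h]
    simp
  · right
    ext a
    rw [hmem, h]
    simp

/-! ### The case of rings -/

/-- Right congruences of a ring correspond to right ideals, so that right CP-rings are the
semisimple rings. -/
theorem isRightCP_iff_isSemisimpleRing {R : Type u} [Ring R] :
    IsRightCP R ↔ IsSemisimpleRing R := by
  rw [← isSemisimpleRing_mulOpposite_iff]
  constructor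
  · rw [isRightCP_iff]
    intro h
    refine (isSemisimpleModule_iff _ _).2 ⟨fun I => ?_⟩
    obtain ⟨e, he, hc⟩ := h
      { r := fun a b => MulOpposite.op (a - b) ∈ I
        iseqv := ⟨fun a => by simp, fun {a b} hab => by simpa using I.neg_mem hab,
          fun {a b d} h1 h2 => by simpa using I.add_mem h1 h2⟩
        add' := fun {a b c d} h1 h2 => by
          have := I.add_mem h1 h2
          rwa [← MulOpposite.op_add, sub_add_sub_comm] at this }
      fun a b s hab => by
        have := I.smul_mem (MulOpposite.op s) hab
        rwa [smul_eq_mul, ← MulOpposite.op_mul, sub_mul] at this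
    have hc' : ∀ a b, MulOpposite.op (a - b) ∈ I ↔ e * a = e * b := hc
    have hI : ∀ x : Rᵐᵒᵖ, x ∈ I ↔ e * x.unop = 0 := fun x => by
      simpa using hc' x.unop 0
    -- As a right ideal, `I` is the right annihilator (1 - e)R of `e`, so eR is a complement.
    refine ⟨Ideal.span {MulOpposite.op e}, ?_, ?_⟩
    · rw [Submodule.disjoint_def]
      intro x hx hx'
      obtain ⟨y, rfl⟩ := Ideal.mem_span_singleton'.1 hx'
      have := (hI _).1 hx
      apply MulOpposite.unop_injective
      simpa [← mul_assoc, he] using this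
    · rw [codisjoint_iff, Ideal.eq_top_iff_one]
      rw [show (1 : Rᵐᵒᵖ) = MulOpposite.op (1 - e) + MulOpposite.op e by
        rw [← MulOpposite.op_add]; simp]
      refine Submodule.add_mem_sup ((hI _).2 ?_) (Ideal.mem_span_singleton_self _)
      simp [mul_sub, he]
  · intro h A _ _ _
    let _ := Module.addCommMonoidToAddCommGroup Rᵐᵒᵖ (M := A)
    exact Module.projective_of_isSemisimpleRing _ _

theorem IsMatrixOverDivisionRing.isSimpleSemiring_and_isRightCP {S : Type u} [Semiring S]
    (h : IsMatrixOverDivisionRing S) : IsSimpleSemiring S ∧ IsRightCP S := by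
  obtain ⟨n, D, _, hn, ⟨φ⟩⟩ := h
  have : NeZero n := ⟨by omega⟩
  have := (isSimpleRing_iff_isTwoSided_imp (R := Matrix (Fin n) (Fin n) D)).1 inferInstance
  refine ⟨⟨IsCongruenceSimple.of_ringEquiv φ fun c => ?_,
    IsIdealSimple.of_ringEquiv φ this.2⟩,
    IsRightCP.of_ringEquiv φ (isRightCP_iff_isSemisimpleRing.2 inferInstance)⟩
  rcases eq_bot_or_eq_top (TwoSidedIdeal.orderIsoRingCon.symm c) with h | h
  · left; simpa using h
  · right; simpa using h

/-- A nontrivial ideal-simple right CP-semiring with additive inverses is a matrix ring. -/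
theorem isMatrixOverDivisionRing_of_neg {S : Type u} [Semiring S] [Nontrivial S]
    (hS : IsIdealSimple S) (hCP : IsRightCP S) (hneg : ∀ a : S, ∃ b, b + a = 0) :
    IsMatrixOverDivisionRing S := by
  choose neg hneg using hneg
  let _ : Neg S := ⟨neg⟩
  let _ : Ring S :=
    { (inferInstance : Semiring S) with
      neg_add_cancel := hneg
      zsmul := zsmulRec }
  have : IsSimpleRing S := isSimpleRing_iff_isTwoSided_imp.2 ⟨inferInstance, hS⟩
  have : IsSemisimpleRing S := isRightCP_iff_isSemisimpleRing.1 hCP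
  obtain ⟨n, hn, D, hD, e⟩ := IsSimpleRing.exists_ringEquiv_matrix_divisionRing S
  exact ⟨n, D, hD, Nat.one_le_iff_ne_zero.2 hn.out, e⟩

/-! ### Prime decompositions and finite distributive lattices -/

open Classical in
/-- The identity of `A` is a finite sum of maps `x ↦ [p x] • m` for prime characters `p`. -/
def HasPrimeDecomposition (A : Type*) [AddCommMonoid A] : Prop :=
  ∃ (n : ℕ) (p : Fin n → A → Prop) (m : Fin n → A),
    (∀ i, ¬ p i 0) ∧ (∀ i x y, p i (x + y) ↔ p i x ∨ p i y) ∧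
      ∀ x, x = ∑ i, if p i x then m i else 0

open Classical in
theorem HasPrimeDecomposition.of_fintype {A ι : Type*} [AddCommMonoid A] [Fintype ι]
    (p : ι → A → Prop) (m : ι → A) (h0 : ∀ i, ¬ p i 0)
    (hadd : ∀ i x y, p i (x + y) ↔ p i x ∨ p i y)
    (hsum : ∀ x, x = ∑ i, if p i x then m i else 0) : HasPrimeDecomposition A := by
  let e := Fintype.equivFin ι
  refine ⟨Fintype.card ι, fun i => p (e.symm i), fun i => m (e.symm i), fun i => h0 _,
    fun i => hadd _, fun x => (hsum x).trans ?_⟩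
  exact Fintype.sum_equiv e _ _ fun i => by simp

theorem HasPrimeDecomposition.add_self {A : Type*} [AddCommMonoid A]
    (h : HasPrimeDecomposition A) (x : A) : x + x = x := by
  obtain ⟨n, p, m, -, hadd, hsum⟩ := h
  refine (hsum (x + x)).trans (Eq.trans (Finset.sum_congr rfl fun i _ => ?_) (hsum x).symm)
  rw [hadd, or_self]

theorem HasPrimeDecomposition.of_retract {A B : Type*} [AddCommMonoid A] [AddCommMonoid B]
    (h : HasPrimeDecomposition A) (r : A →+ B) (s : B →+ A) (hrs : ∀ b, r (s b) = b) :
    HasPrimeDecomposition B := by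
  obtain ⟨n, p, m, h0, hadd, hsum⟩ := h
  refine ⟨n, fun i b => p i (s b), fun i => r (m i), fun i => by simpa using h0 i,
    fun i x y => by simp [hadd], fun b => ?_⟩
  conv_lhs => rw [← hrs b, hsum (s b), map_sum]
  exact Finset.sum_congr rfl fun i _ => by split_ifs <;> simp

theorem HasPrimeDecomposition.finite {A : Type*} [AddCommMonoid A]
    (h : HasPrimeDecomposition A) : Finite A := by
  obtain ⟨n, p, m, -, -, hsum⟩ := h
  refine Finite.of_injective (fun x i => p i x) fun x y hxy => ?_
  rw [hsum x, hsum y]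
  exact Finset.sum_congr rfl fun i _ => by rw [show p i x = p i y from congrFun hxy i]

-- This is projectivity among additively idempotent monoids: lift each `m i` arbitrarily and extend
-- by the characters. Idempotence of `A` makes the extension additive.
open Classical in
theorem HasPrimeDecomposition.exists_section {A B : Type*} [AddCommMonoid A] [AddCommMonoid B]
    (hA : ∀ x : A, x + x = x) (h : HasPrimeDecomposition B) (r : A →+ B)
    (hr : Function.Surjective r) : ∃ s : B →+ A, ∀ b, r (s b) = b := by
  obtain ⟨n, p, m, h0, hadd, hsum⟩ := h
  choose l hl using fun i => hr (m i)
  refine ⟨{ toFun := fun b => ∑ i, if p i b then l i else 0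
            map_zero' := by simp [h0]
            map_add' := fun x y => ?_ }, fun b => ?_⟩
  · rw [← Finset.sum_add_distrib]
    refine Finset.sum_congr rfl fun i _ => ?_
    by_cases hx : p i x <;> by_cases hy : p i y <;> simp [hadd, hx, hy, hA]
  · change r (∑ i, if p i b then l i else 0) = b
    conv_rhs => rw [hsum b]
    rw [map_sum]
    exact Finset.sum_congr rfl fun i _ => by split_ifs <;> simp [hl]

/-- A finite join-semilattice with zero in which `w ≤ x + y` and `w ≤ x + z` imply `w ≤ x + v` for
some common lower bound `v` of `y` and `z` is a distributive lattice. -/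
theorem exists_distribLattice {A : Type*} [AddCommMonoid A] [Finite A] (hA : ∀ x : A, x + x = x)
    (h : ∀ x y z w : A, w + (x + y) = x + y → w + (x + z) = x + z →
      ∃ v, v + y = y ∧ v + z = z ∧ w + (x + v) = x + v) :
    ∃ L : DistribLattice A, ∀ x y, L.sup x y = x + y := by
  let _ : SemilatticeSup A :=
    { sup := (· + ·)
      le := fun x y => x + y = y
      le_refl := hA
      le_trans := fun x y z (hxy : x + y = y) (hyz : y + z = z) => by
        rw [← hyz, ← add_assoc, hxy]
      le_antisymm := fun x y (hxy : x + y = y) (hyx : y + x = x) => by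
        rw [← hyx, add_comm, hxy]
      le_sup_left := fun x y => by
        rw [← add_assoc, hA]
      le_sup_right := fun x y => by
        rw [add_left_comm, hA]
      sup_le := fun x y z (hxz : x + z = z) (hyz : y + z = z) => by
        rw [add_assoc, hyz, hxz] }
  let _ : OrderBot A := { bot := 0, bot_le := fun x => zero_add x }
  -- By finiteness, the meet is the join of all common lower bounds.
  let I : A → A → Finset A := fun x y => (Set.toFinite {z | z ≤ x ∧ z ≤ y}).toFinset
  have hI : ∀ x y z, z ∈ I x y ↔ z ≤ x ∧ z ≤ y := fun x y z => by simp [I]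
  refine ⟨{ (inferInstance : SemilatticeSup A) with
    inf := fun x y => (I x y).sup id
    inf_le_left := fun x y => Finset.sup_le fun z hz => ((hI x y z).1 hz).1
    inf_le_right := fun x y => Finset.sup_le fun z hz => ((hI x y z).1 hz).2
    le_inf := fun x y z hy hz => Finset.le_sup (f := id) ((hI y z x).2 ⟨hy, hz⟩)
    le_sup_inf := fun x y z => ?_ }, fun x y => rfl⟩
  refine Finset.sup_le fun w hw => ?_
  obtain ⟨v, hvy, hvz, hw⟩ := h x y z w ((hI _ _ w).1 hw).1 ((hI _ _ w).1 hw).2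
  exact le_trans (b := x ⊔ v) hw
    (sup_le_sup_left (Finset.le_sup (f := id) ((hI y z v).2 ⟨hvy, hvz⟩)) x)

-- Each `m i` lies below every element on which `p i` holds. The sum of the `m i` whose character
-- holds on both y and z therefore serves as v: a character that holds on w but not on x must hold
-- on both y and z.
open Classical in
theorem HasPrimeDecomposition.exists_distribLattice {A : Type*} [AddCommMonoid A]
    (h : HasPrimeDecomposition A) : ∃ L : DistribLattice A, ∀ x y, L.sup x y = x + y := by
  have hA := h.add_self
  have := h.finite
  obtain ⟨n, p, m, h0, hadd, hsum⟩ := h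
  have hle : ∀ x y : A, (∀ i, p i x → m i + y = y) → x + y = y := fun x y hxy => by
    have : ∀ z, z = ∑ i, (if p i x then m i else 0) → z + y = y := by
      rintro z rfl
      refine Finset.sum_induction _ (fun z => z + y = y) (fun a b ha hb => ?_) (zero_add y)
        fun i _ => ?_
      · rw [add_assoc, hb, ha]
      · split_ifs with hi
        · exact hxy i hi
        · exact zero_add y
    exact this x (hsum x)
  have hm : ∀ i x, p i x → m i + x = x := fun i x hi => by
    have : ∀ z, z = ∑ i, (if p i x then m i else 0) → m i + z = z := by
      rintro z rfl
      rw [← Finset.add_sum_erase _ _ (Finset.mem_univ i), if_pos hi, ← add_assoc, hA]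
    exact this x (hsum x)
  have hp : ∀ i x y, x + y = y → p i x → p i y := fun i x y hxy hx => by
    rw [← hxy, hadd]; exact .inl hx
  refine _root_.exists_distribLattice hA fun x y z w hwy hwz =>
    ⟨∑ i, if p i y ∧ p i z then m i else 0, ?_, ?_, ?_⟩
  · refine Finset.sum_induction _ (fun v => v + y = y)
      (fun a b ha hb => by rw [add_assoc, hb, ha]) (zero_add y) fun i _ => ?_
    split_ifs with hi
    · exact hm i y hi.1
    · exact zero_add y
  · refine Finset.sum_induction _ (fun v => v + z = z)
      (fun a b ha hb => by rw [add_assoc, hb, ha]) (zero_add z) fun i _ => ?_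
    split_ifs with hi
    · exact hm i z hi.2
    · exact zero_add z
  · refine hle _ _ fun i hi => ?_
    by_cases hx : p i x
    · rw [← add_assoc, hm i x hx]
    · have hy : p i y := ((hadd i x y).1 (hp i _ _ hwy hi)).resolve_left hx
      have hz : p i z := ((hadd i x z).1 (hp i _ _ hwz hi)).resolve_left hx
      rw [← Finset.add_sum_erase _ _ (Finset.mem_univ i), if_pos ⟨hy, hz⟩, add_left_comm,
        ← add_assoc (m i) (m i), hA]

-- In a distributive lattice the join-irreducible elements are join-prime, so "lying above j" is a
-- prime character; by finiteness every element is the join of the join-irreducibles below it.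
open Classical in
theorem HasPrimeDecomposition.of_distribLattice {A : Type*} [AddCommMonoid A] [Finite A]
    (L : DistribLattice A) (hL : ∀ x y, L.sup x y = x + y) : HasPrimeDecomposition A := by
  have hL' : ∀ x y : A, x ⊔ y = x + y := hL
  let _ : OrderBot A :=
    { bot := 0, bot_le := fun x => by rw [← sup_eq_right, hL', zero_add] }
  have hbot : (⊥ : A) = 0 := rfl
  have := Fintype.ofFinite {j : A // SupPrime j}
  refine HasPrimeDecomposition.of_fintype (ι := {j : A // SupPrime j}) (fun j x => j.1 ≤ x)
    (fun j => j.1) (fun j => ?_) (fun j x y => ?_) fun x => le_antisymm ?_ ?_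
  · rw [← hbot, le_bot_iff]
    exact j.2.ne_bot
  · rw [← hL', j.2.le_sup]
  · obtain ⟨s, hs, hirr⟩ := exists_supIrred_decomposition x
    conv_lhs => rw [← hs]
    refine Finset.sup_le fun b hb => ?_
    have hbx : b ≤ x := hs ▸ Finset.le_sup (f := id) hb
    rw [← Finset.add_sum_erase _ _ (Finset.mem_univ ⟨b, supPrime_iff_supIrred.2 (hirr hb)⟩),
      if_pos hbx, ← hL']
    exact le_sup_left
  · refine Finset.sum_induction _ (· ≤ x) (fun a b ha hb => ?_) (hbot ▸ bot_le) fun j _ => ?_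
    · rw [← hL']; exact sup_le ha hb
    · split_ifs with hj
      · exact hj
      · exact hbot ▸ bot_le

theorem hasPrimeDecomposition_iff_exists_distribLattice {A : Type*} [AddCommMonoid A] [Finite A] :
    HasPrimeDecomposition A ↔ ∃ L : DistribLattice A, ∀ x y, L.sup x y = x + y :=
  ⟨fun h => h.exists_distribLattice, fun ⟨L, hL⟩ => .of_distribLattice L hL⟩

/-! ### Endomorphism semirings -/

open Classical in
/-- The endomorphism `x ↦ [p x] • m`. -/
noncomputable def rankOneEnd {A : Type*} [AddCommMonoid A] (hA : ∀ x : A, x + x = x) (p : A → Prop)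
    (h0 : ¬ p 0) (hadd : ∀ x y, p (x + y) ↔ p x ∨ p y) (m : A) : AddMonoid.End A where
  toFun x := if p x then m else 0
  map_zero' := if_neg h0
  map_add' x y := by by_cases hx : p x <;> by_cases hy : p y <;> simp [hadd, hx, hy, hA]

/-- The identity is the sum of the rank-one maps `E j (m j)`, and each of these factors through any
nonzero `f`: send the support of `p j` to a point x with `p i (f x)`, apply `f`, then send the
support of `p i` to `m j`. -/
theorem HasPrimeDecomposition.isIdealSimple_end {A : Type u} [AddCommMonoid A]
    (h : HasPrimeDecomposition A) : IsIdealSimple (AddMonoid.End A) := by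
  classical
  have hA := h.add_self
  obtain ⟨n, p, m, h0, hadd, hsum⟩ := h
  let E := fun i => rankOneEnd hA (p i) (h0 i) (hadd i)
  have hE : ∀ i m x, E i m x = if p i x then m else 0 := fun _ _ _ => rfl
  have hone : (1 : AddMonoid.End A) = ∑ j, E j (m j) := by
    ext x
    exact (hsum x).trans (AddMonoidHom.finsetSum_apply (fun j => E j (m j)) Finset.univ x).symm
  intro I hI
  refine or_iff_not_imp_left.2 fun hbot => ?_
  obtain ⟨f, hf, hf0⟩ := Submodule.exists_mem_ne_zero_of_ne_bot hbot
  have : ∃ x, f x ≠ 0 := by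
    by_contra! hx
    exact hf0 (AddMonoidHom.ext hx)
  obtain ⟨x, hx⟩ := this
  have : ∃ i, p i (f x) := by
    by_contra! hi
    apply hx
    rw [hsum (f x)]
    simp [hi]
  obtain ⟨i, hi⟩ := this
  rw [Ideal.eq_top_iff_one, hone]
  refine Ideal.sum_mem _ fun j _ => ?_
  have : E j (m j) = E i (m j) * f * E j x := by
    ext y
    change E j (m j) y = E i (m j) (f (E j x y))
    by_cases hy : p j y <;> simp [hE, hy, hi, h0]
  rw [this]
  exact I.mul_mem_right _ (I.mul_mem_left _ hf)

/-- If some character separates f x from g x for congruent f and g, sandwiching them between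
rank-one maps makes every summand of the identity congruent to 0. Otherwise all characters agree on
f x and g x, and they determine the values. -/
theorem HasPrimeDecomposition.isCongruenceSimple_end {A : Type u} [AddCommMonoid A]
    (h : HasPrimeDecomposition A) : IsCongruenceSimple (AddMonoid.End A) := by
  classical
  have hA := h.add_self
  obtain ⟨n, p, m, h0, hadd, hsum⟩ := h
  let E := fun i => rankOneEnd hA (p i) (h0 i) (hadd i)
  have hE : ∀ i m x, E i m x = if p i x then m else 0 := fun _ _ _ => rfl
  have hone : (1 : AddMonoid.End A) = ∑ j, E j (m j) := by
    ext x
    exact (hsum x).trans (AddMonoidHom.finsetSum_apply (fun j => E j (m j)) Finset.univ x).symm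
  intro c
  have key : ∀ f g : AddMonoid.End A, c f g → ∀ i x, p i (f x) → ¬ p i (g x) → c = ⊤ := by
    intro f g hfg i x hf hg
    have hc : ∀ j, c (E j (m j)) 0 := fun j => by
      have h1 : E j (m j) = E i (m j) * f * E j x := by
        ext y
        change E j (m j) y = E i (m j) (f (E j x y))
        by_cases hy : p j y <;> simp [hE, hy, hf, h0]
      have h2 : 0 = E i (m j) * g * E j x := by
        ext y
        change 0 = E i (m j) (g (E j x y))
        by_cases hy : p j y <;> simp [hE, hy, hg, h0]
      rw [h1, h2]
      exact c.mul (c.mul (c.refl _) hfg) (c.refl _)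
    have hc1 : c 1 0 := by
      rw [hone]
      refine Finset.sum_induction _ (fun f => c f 0) (fun a b ha hb => ?_) (c.refl 0)
        fun j _ => hc j
      simpa using c.add ha hb
    have hc0 : ∀ f, c f 0 := fun f => by simpa using c.mul hc1 (c.refl f)
    ext f g
    simpa using c.trans (hc0 f) (c.symm (hc0 g))
  refine or_iff_not_imp_right.2 fun htop => ?_
  ext f g
  refine ⟨fun hfg => ?_, fun hfg => (show f = g from hfg) ▸ c.refl f⟩
  change f = g
  ext x
  rw [hsum (f x), hsum (g x)]
  refine Finset.sum_congr rfl fun i _ => ?_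
  have : p i (f x) ↔ p i (g x) :=
    ⟨fun h1 => by_contra fun h2 => htop (key f g hfg i x h1 h2),
      fun h1 => by_contra fun h2 => htop (key g f (c.symm hfg) i x h1 h2)⟩
  simp only [this]

/-- The right congruences of `End A` correspond to the congruences of `A`. -/
theorem HasPrimeDecomposition.isRightCP_end_iff {A : Type u} [AddCommMonoid A]
    (h : HasPrimeDecomposition A) :
    IsRightCP (AddMonoid.End A) ↔ ∀ θ : AddCon A, HasPrimeDecomposition θ.Quotient := by
  classical
  have hA := h.add_self
  have hAD := h
  obtain ⟨n, p, m, h0, hadd, hsum⟩ := h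
  let E := fun i => rankOneEnd hA (p i) (h0 i) (hadd i)
  have hE : ∀ i m x, E i m x = if p i x then m else 0 := fun _ _ _ => rfl
  have hfE : ∀ (f : AddMonoid.End A) i x, f * E i x = E i (f x) := fun f i x => by
    ext y
    change f (E i x y) = E i (f x) y
    by_cases hy : p i y <;> simp [hE, hy]
  have hone : (1 : AddMonoid.End A) = ∑ j, E j (m j) := by
    ext x
    exact (hsum x).trans (AddMonoidHom.finsetSum_apply (fun j => E j (m j)) Finset.univ x).symm
  rw [isRightCP_iff]
  constructor
  · intro hCP θ
    -- The pointwise congruence induced by `θ` yields an idempotent `e` whose kernel is `θ`; it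
    -- descends to a section of the quotient map.
    obtain ⟨e, he, hc⟩ := hCP
      { r := fun f g => ∀ x, θ (f x) (g x)
        iseqv := ⟨fun f x => θ.refl _, fun hfg x => θ.symm (hfg x),
          fun hfg hgh x => θ.trans (hfg x) (hgh x)⟩
        add' := fun h1 h2 x => θ.add (h1 x) (h2 x) }
      fun f g s hfg x => hfg (s x)
    have hc' : ∀ f g : AddMonoid.End A, (∀ x, θ (f x) (g x)) ↔ e * f = e * g := hc
    have hee : ∀ x, e (e x) = e x := fun x => DFunLike.congr_fun he x
    have hθe : ∀ x, θ (e x) x := (hc' e 1).2 (by rw [he, mul_one])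
    have heθ : ∀ x y, θ x y → e x = e y := fun x y hxy => by
      -- If no character ever holds, then `A` is zero; otherwise rank-one maps with values `x` and
      -- `y` transfer the relation from points to endomorphisms.
      by_cases hi : ∃ i z, p i z
      · obtain ⟨i, z, hz⟩ := hi
        have := (hc' (E i x) (E i y)).1 fun w => by
          by_cases hw : p i w <;> simp [hE, hw, hxy, θ.refl]
        rw [hfE, hfE] at this
        simpa [hE, hz] using DFunLike.congr_fun this z
      · push Not at hi
        rw [hsum x, hsum y]
        simp [hi]
    refine hAD.of_retract θ.mk' (θ.lift e fun x y hxy => heθ x y hxy) fun q => ?_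
    induction q using AddCon.induction_on with
    | H x => exact (AddCon.eq θ).2 (hθe x)
  · intro hq c hc
    -- Rank-one maps embed `A` in its endomorphism semiring, and `θ` is the restriction of `c`.
    -- Since f is the sum of the maps `E i (f (m i))`, this restriction determines `c`.
    let θ : AddCon A :=
      { r := fun x y => ∀ i, c (E i x) (E i y)
        iseqv := ⟨fun f x => c.refl _, fun hfg x => c.symm (hfg x),
          fun hfg hgh x => c.trans (hfg x) (hgh x)⟩
        add' := fun {w x y z} h1 h2 i => by
          have hEadd : ∀ x y, E i (x + y) = E i x + E i y := fun x y => by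
            ext w
            change E i (x + y) w = E i x w + E i y w
            by_cases hw : p i w <;> simp [hE, hw]
          rw [hEadd, hEadd]
          exact c.add (h1 i) (h2 i) }
    have hcθ : ∀ f g : AddMonoid.End A, c f g ↔ ∀ x, θ (f x) (g x) := fun f g => by
      refine ⟨fun hfg x i => ?_, fun hfg => ?_⟩
      · rw [← hfE, ← hfE]
        exact hc _ _ _ hfg
      · rw [← mul_one f, ← mul_one g, hone, Finset.mul_sum, Finset.mul_sum]
        refine c.finsetSum _ fun i _ => ?_
        rw [hfE, hfE]
        exact hfg (m i) i
    obtain ⟨s, hs⟩ := (hq θ).exists_section hA θ.mk' AddCon.mk'_surjective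
    refine ⟨s.comp θ.mk', ?_, fun f g => ?_⟩
    · ext x
      change s (θ.mk' (s (θ.mk' x))) = s (θ.mk' x)
      rw [hs]
    · rw [hcθ, DFunLike.ext_iff]
      refine forall_congr' fun x => ?_
      change _ ↔ s (θ.mk' (f x)) = s (θ.mk' (g x))
      rw [(Function.LeftInverse.injective hs).eq_iff]
      exact (AddCon.eq θ).symm

/-! ### Distributive quotients and the interval condition -/

/-- Any element other than two given incomparable ones lies above both or below both. -/
def IncomparablePairsIsolated (M : Type u) [LE M] : Prop :=
  ∀ x y : M, ¬ x ≤ y → ¬ y ≤ x →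
    ∀ z, z = x ∨ z = y ∨ (z ≤ x ∧ z ≤ y) ∨ (x ≤ z ∧ y ≤ z)

/-- The nearest elements t below and t' above x in T(M) enclose y as well, so [t, t'] must be
Boolean with x and y as its middle elements. Anything outside the interval lies above or below both.
-/
theorem IntervalCondition.incomparablePairsIsolated {M : Type u} [Lattice M] [OrderBot M]
    [Finite M] (h : IntervalCondition M) : IncomparablePairsIsolated M := by
  intro x y hxy hyx z
  obtain ⟨top, htop⟩ : ∃ top : M, ∀ z, z ≤ top := by
    obtain ⟨m, hm⟩ := Set.finite_univ.exists_maximal (α := M) ⟨⊥, trivial⟩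
    exact ⟨m, fun z => le_sup_right.trans (hm.2 (y := m ⊔ z) trivial le_sup_left)⟩
  obtain ⟨t, ⟨ht, htx⟩, htmax⟩ := (Set.toFinite {u ∈ comparableSet M | u ≤ x}).exists_maximal
    ⟨⊥, fun _ => .inr bot_le, bot_le⟩
  obtain ⟨t', ⟨ht', hxt'⟩, htmin⟩ := (Set.toFinite {u ∈ comparableSet M | x ≤ u}).exists_minimal
    ⟨top, fun z => .inl (htop z), htop x⟩
  have hxT : ∀ u ∈ comparableSet M, u ≠ x := by
    rintro u hu rfl
    exact (hu y).elim hyx hxy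
  have hty : t ≤ y := (ht y).resolve_left fun h => hyx (h.trans htx)
  have hyt' : y ≤ t' := (ht' y).resolve_right fun h => hxy (hxt'.trans h)
  have hT : Set.Icc t t' ∩ comparableSet M = {t, t'} := by
    refine Set.Subset.antisymm (fun u hu => ?_) ?_
    · rcases hu.2 x with hxu | hux
      · exact .inr (le_antisymm hu.1.2 (htmin ⟨hu.2, hxu⟩ hu.1.2))
      · exact .inl (le_antisymm (htmax ⟨hu.2, hux⟩ hu.1.1) hu.1.1)
    · rintro u (rfl | rfl)
      · exact ⟨⟨le_rfl, htx.trans hxt'⟩, ht⟩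
      · exact ⟨⟨htx.trans hxt', le_rfl⟩, ht'⟩
  rcases h t ht t' ht' (htx.trans hxt') hT with hI | ⟨⟨e⟩⟩
  · have hx : x ∈ ({t, t'} : Set M) := hI ▸ ⟨htx, hxt'⟩
    rcases hx with rfl | rfl
    · exact absurd rfl (hxT _ ht)
    · exact absurd rfl (hxT _ ht')
  · rcases ht z with hzt | htz
    · exact .inr (.inr (.inl ⟨hzt.trans htx, hzt.trans hty⟩))
    rcases ht' z with hzt' | htz'
    swap
    · exact .inr (.inr (.inr ⟨hxt'.trans htz', hyt'.trans htz'⟩))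
    have key : ∀ p q r : Bool × Bool, ¬ p ≤ q → ¬ q ≤ p →
        r = p ∨ r = q ∨ (r ≤ p ∧ r ≤ q) ∨ (p ≤ r ∧ q ≤ r) := by decide
    have := key (e ⟨x, htx, hxt'⟩) (e ⟨y, hty, hyt'⟩) (e ⟨z, htz, hzt'⟩)
    simp only [e.le_iff_le, e.injective.eq_iff] at this
    exact (this hxy hyx).imp (congrArg Subtype.val) (Or.imp_left (congrArg Subtype.val))

/-- An element x strictly between t and t' is incomparable to some y. Isolation makes x ⊔ y and x ⊓
y comparable to everything, hence equal to t' and t, and leaves no room for a fifth element. -/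
theorem IncomparablePairsIsolated.intervalCondition {M : Type u} [Lattice M]
    (h : IncomparablePairsIsolated M) : IntervalCondition M := by
  intro t ht t' ht' htt' hT
  refine or_iff_not_imp_left.2 fun hne => ?_
  have : ∃ x ∈ Set.Icc t t', x ≠ t ∧ x ≠ t' := by
    by_contra! hcon
    refine hne (Set.Subset.antisymm (fun x hx => ?_) ?_)
    · by_cases hxt : x = t
      · exact .inl hxt
      · exact .inr (hcon x hx hxt)
    · rintro x (rfl | rfl)
      · exact ⟨le_rfl, htt'⟩
      · exact ⟨htt', le_rfl⟩
  obtain ⟨x, hx, hxt, hxt'⟩ := this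
  have hT' : ∀ u, t ≤ u → u ≤ t' → u ∈ comparableSet M → u = t ∨ u = t' := fun u h1 h2 h3 => by
    have : u ∈ Set.Icc t t' ∩ comparableSet M := ⟨⟨h1, h2⟩, h3⟩
    rwa [hT] at this
  have hxT : x ∉ comparableSet M := fun hxT => (hT' x hx.1 hx.2 hxT).elim hxt hxt'
  obtain ⟨y, hyx, hxy⟩ : ∃ y, ¬ y ≤ x ∧ ¬ x ≤ y := by simpa [comparableSet] using hxT
  have hty : t ≤ y := (ht y).resolve_left fun hyt => hyx (hyt.trans hx.1)
  have hyt' : y ≤ t' := (ht' y).resolve_right fun hty => hxy (hx.2.trans hty)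
  have hP := h x y hxy hyx
  have hsup : x ⊔ y = t' := by
    refine (hT' _ (hx.1.trans le_sup_left) (sup_le hx.2 hyt') fun z => ?_).resolve_left fun hst =>
      hxt (le_antisymm (hst ▸ le_sup_left) hx.1)
    rcases hP z with rfl | rfl | h | h
    · exact .inl le_sup_left
    · exact .inl le_sup_right
    · exact .inl (h.1.trans le_sup_left)
    · exact .inr (sup_le h.1 h.2)
  have hinf : x ⊓ y = t := by
    refine (hT' _ (le_inf hx.1 hty) (inf_le_left.trans hx.2) fun z => ?_).resolve_right fun hst =>
      hxt' (le_antisymm hx.2 (hst ▸ inf_le_left))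
    rcases hP z with rfl | rfl | h | h
    · exact .inr inf_le_left
    · exact .inr inf_le_right
    · exact .inl (le_inf h.1 h.2)
    · exact .inr (inf_le_left.trans h.1)
  have hcases : ∀ z ∈ Set.Icc t t', z = t ∨ z = x ∨ z = y ∨ z = t' := fun z hz => by
    rcases hP z with h | h | h | h
    · exact .inr (.inl h)
    · exact .inr (.inr (.inl h))
    · exact .inl (le_antisymm (hinf ▸ le_inf h.1 h.2) hz.1)
    · exact .inr (.inr (.inr (le_antisymm hz.2 (hsup ▸ sup_le h.1 h.2))))
  have h1 : ¬ x ≤ t := fun h => hxt (le_antisymm h hx.1)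
  have h2 : ¬ t' ≤ x := fun h => hxt' (le_antisymm hx.2 h)
  have h3 : ¬ y ≤ t := fun h => hyx (h.trans hx.1)
  have h4 : ¬ t' ≤ y := fun h => hxy (hx.2.trans h)
  have h5 : ¬ t' ≤ t := fun h => h2 (h.trans hx.1)
  let f : Bool × Bool → M := fun p =>
    bif p.1 then (bif p.2 then t' else x) else (bif p.2 then y else t)
  have hf : ∀ p q, f p ≤ f q ↔ p ≤ q := by
    rintro ⟨_ | _, _ | _⟩ ⟨_ | _, _ | _⟩ <;>
      simp [f, h1, h2, h3, h4, h5, hxy, hyx, hx.1, hx.2, hty, hyt', htt',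
        show ¬ (true ≤ false) by decide]
  have hmem : ∀ p, f p ∈ Set.Icc t t' := by
    rintro ⟨_ | _, _ | _⟩
    · exact ⟨le_rfl, htt'⟩
    · exact ⟨hty, hyt'⟩
    · exact hx
    · exact ⟨htt', le_rfl⟩
  refine ⟨(RelIso.ofSurjective (OrderEmbedding.ofMapLEIff (β := Set.Icc t t')
    (fun p => ⟨f p, hmem p⟩) hf) ?_).symm⟩
  rintro ⟨z, hz⟩
  rcases hcases z hz with rfl | rfl | rfl | rfl
  · exact ⟨(false, false), rfl⟩
  · exact ⟨(true, false), rfl⟩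
  · exact ⟨(false, true), rfl⟩
  · exact ⟨(true, true), rfl⟩

/-- Isolation passes to quotients, because elements incomparable in the quotient have incomparable
representatives. It makes distributivity trivial: if y and z are incomparable, then x lies above one
of them or below both. -/
theorem IncomparablePairsIsolated.quotientsDistributive {M : Type u} [SemilatticeSup M] [OrderBot M]
    [Finite M] (h : IncomparablePairsIsolated M) : QuotientsDistributive M := by
  intro θ
  have hle : ∀ x y : M, x ≤ y ↔ (show JoinMonoid M from x) + (show JoinMonoid M from y) = y := fun x y =>
    sup_eq_right.symm
  have hA : ∀ q : θ.Quotient, q + q = q := fun q => by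
    induction q using AddCon.induction_on with
    | H x => exact congrArg (AddCon.toQuotient (c := θ)) (sup_idem (α := M) x)
  have hP : ∀ x y z : θ.Quotient, x + y ≠ y → y + x ≠ x →
      z = x ∨ z = y ∨ (z + x = x ∧ z + y = y) ∨ (x + z = z ∧ y + z = z) := fun x y z => by
    induction x using AddCon.induction_on with | H x =>
    induction y using AddCon.induction_on with | H y =>
    induction z using AddCon.induction_on with | H z =>
    intro hxy hyx
    have hco : ∀ u v : JoinMonoid M, (show M from u) ≤ v →
        (u : θ.Quotient) + (v : θ.Quotient) = v := fun u v huv =>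
      congrArg (AddCon.toQuotient (c := θ)) ((hle u v).1 huv)
    rcases h x y (fun hle => hxy (hco x y hle)) (fun hle => hyx (hco y x hle)) z with
      h | h | h | h
    · exact .inl (congrArg (AddCon.toQuotient (c := θ)) h)
    · exact .inr (.inl (congrArg (AddCon.toQuotient (c := θ)) h))
    · exact .inr (.inr (.inl ⟨hco _ _ h.1, hco _ _ h.2⟩))
    · exact .inr (.inr (.inr ⟨hco _ _ h.1, hco _ _ h.2⟩))
  have : Finite (JoinMonoid M) := ‹Finite M›
  have : Finite θ.Quotient := Quotient.finite _
  refine exists_distribLattice hA fun x y z w hwy hwz => ?_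
  by_cases hyz : y + z = z
  · exact ⟨y, hA y, hyz, hwy⟩
  by_cases hzy : z + y = y
  · exact ⟨z, hzy, hA z, hwz⟩
  rcases hP y z x hyz hzy with rfl | rfl | h | h
  · exact ⟨0, zero_add _, zero_add _, by rwa [hA, ← add_zero x] at hwy⟩
  · exact ⟨0, zero_add _, zero_add _, by rwa [hA, ← add_zero x] at hwz⟩
  · rw [h.1] at hwy
    rw [h.2] at hwz
    exact ⟨w, hwy, hwz, by rw [add_left_comm, hA]⟩
  · exact ⟨0, zero_add _, zero_add _, by rwa [add_comm x y, h.1, ← add_zero x] at hwy⟩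

/-- The consequence of distributivity of the quotient in which `x` and `y` are identified if they
have the same upper bounds among `a`, `b`, `c`. -/
theorem QuotientsDistributive.le_of_inf_le {M : Type u} [Lattice M] [OrderBot M]
    (h : QuotientsDistributive M) {a b c : M} (hbc : ¬ b ≤ c) (hcb : ¬ c ≤ b)
    (ha : ¬ (b ≤ a ∧ c ≤ a)) (hinf : a ⊓ c ≤ b) : a ≤ b := by
  let C : Set M := {a, b, c}
  let θ : AddCon (JoinMonoid M) :=
    { r := fun x y => ∀ u ∈ C, (show M from x) ≤ u ↔ (show M from y) ≤ u
      iseqv := ⟨fun x u hu => Iff.rfl, fun hxy u hu => (hxy u hu).symm,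
        fun hxy hyz u hu => (hxy u hu).trans (hyz u hu)⟩
      add' := fun {w x y z} h1 h2 u hu =>
        sup_le_iff.trans ((and_congr (h1 u hu) (h2 u hu)).trans sup_le_iff.symm) }
  have hθ : ∀ x y : JoinMonoid M, (x : θ.Quotient) = y ↔
      ∀ u ∈ C, (show M from x) ≤ u ↔ (show M from y) ≤ u := fun x y => AddCon.eq θ
  obtain ⟨L, hL⟩ := h θ
  let q : M → θ.Quotient := fun x => ((show JoinMonoid M from x : JoinMonoid M) : θ.Quotient)
  have hqs : ∀ x y, q (x ⊔ y) = q x ⊔ q y := fun x y => (hL (q x) (q y)).symm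
  have hq : ∀ x y, q x ≤ q y ↔ ∀ u ∈ C, y ≤ u → x ≤ u := fun x y => by
    rw [← sup_eq_right, ← hqs]
    refine (hθ _ _).trans (forall₂_congr fun u _ => ?_)
    change (x ⊔ y ≤ u ↔ y ≤ u) ↔ (y ≤ u → x ≤ u)
    rw [sup_le_iff]
    tauto
  have hsurj : ∀ z, ∃ x, q x = z := fun z => by
    induction z using AddCon.induction_on with | H x => exact ⟨x, rfl⟩
  have haC : a ∈ C := by simp [C]
  have hbC : b ∈ C := by simp [C]
  have hcC : c ∈ C := by simp [C]
  -- None of `a`, `b`, `c` is an upper bound of both `b` and `c`, so their join becomes the top of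
  -- the quotient.
  have h1 : q a ≤ q b ⊔ q c := by
    rw [← hqs, hq]
    rintro u (rfl | rfl | rfl) hu
    · exact absurd ⟨le_sup_left.trans hu, le_sup_right.trans hu⟩ ha
    · exact absurd (le_sup_right.trans hu) hcb
    · exact absurd (le_sup_left.trans hu) hbc
  -- The quotient meet need not be the image of the meet in `M`, but any representative of it lies
  -- below both `a` and `c`.
  have h2 : q a ⊓ q c ≤ q b := by
    obtain ⟨v, hv⟩ := hsurj (q a ⊓ q c)
    rw [← hv, hq]
    have hva : v ≤ a := (hq v a).1 (hv ▸ inf_le_left) a haC le_rfl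
    have hvc : v ≤ c := (hq v c).1 (hv ▸ inf_le_right) c hcC le_rfl
    exact fun u _ hu => ((le_inf hva hvc).trans hinf).trans hu
  have h3 : q a ≤ q b := by
    rw [← inf_eq_left.2 h1, inf_sup_left]
    exact sup_le inf_le_right h2
  exact (hq a b).1 h3 b hbC le_rfl

/-- A violating z is comparable to exactly one of x and y, or to neither. So it suffices to exclude
a chain p < q with both members incomparable to r, and a three-element antichain. -/
theorem QuotientsDistributive.incomparablePairsIsolated {M : Type u} [Lattice M] [OrderBot M]
    (h : QuotientsDistributive M) : IncomparablePairsIsolated M := by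
  have chain : ∀ p q r : M, p < q → ¬ p ≤ r → ¬ r ≤ p → ¬ q ≤ r → ¬ r ≤ q → False := by
    intro p q r hpq hpr hrp hqr hrq
    -- If the meet is not below `p`, then `q ⊓ r` and `p` are themselves incomparable and the lemma
    -- applies to `r` with that pair.
    by_cases hs : q ⊓ r ≤ p
    · exact hpq.not_ge (h.le_of_inf_le hpr hrp (fun h => hrq h.2) hs)
    · exact hrq ((h.le_of_inf_le (a := r) (b := q ⊓ r) (c := p) hs
        (fun h => hpr (h.trans inf_le_right)) (fun h => hpr h.2)
        (le_inf (inf_le_right.trans hpq.le) inf_le_left)).trans inf_le_left)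
  have antichain : ∀ x y z : M, ¬ x ≤ y → ¬ y ≤ x → ¬ x ≤ z → ¬ z ≤ x → ¬ y ≤ z → ¬ z ≤ y →
      False := by
    intro x y z hxy hyx hxz hzx hyz hzy
    have h1 : ¬ x ⊓ z ≤ y := fun hle => hxy (h.le_of_inf_le hyz hzy (fun h => hyx h.1) hle)
    have h2 : ¬ y ⊓ z ≤ x := fun hle => hyx (h.le_of_inf_le hxz hzx (fun h => hxy h.1) hle)
    exact hxz ((h.le_of_inf_le (a := x) (b := x ⊓ z) (c := y ⊓ z)
      (fun h => h1 (h.trans inf_le_left)) (fun h => h2 (h.trans inf_le_left)) (fun h => h2 h.2)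
      (le_inf inf_le_left (inf_le_right.trans inf_le_right))).trans inf_le_right)
  intro x y hxy hyx z
  by_contra! hz
  obtain ⟨hzx, hzy, hlow, hup⟩ := hz
  have lt_of : ∀ {u v : M}, u ≤ v → u ≠ v → u < v := lt_of_le_of_ne
  by_cases h1 : z ≤ x
  · by_cases h2 : y ≤ z
    · exact hyx (h2.trans h1)
    · exact chain z x y (lt_of h1 hzx) (hlow h1) h2 hxy hyx
  by_cases h2 : z ≤ y
  · by_cases h3 : x ≤ z
    · exact hxy (h3.trans h2)
    · exact chain z y x (lt_of h2 hzy) h1 h3 hyx hxy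
  by_cases h3 : x ≤ z
  · exact chain x z y (lt_of h3 hzx.symm) hxy hyx h2 (hup h3)
  by_cases h4 : y ≤ z
  · exact chain y z x (lt_of h4 hzy.symm) hyx hxy h1 h3
  · exact antichain x y z hxy hyx h3 h1 h4 h2

/-! ### Structure of ideal-simple right CP-semirings -/

/-- In an ideal-simple semiring either all elements or no nonzero elements have a negative. -/
theorem IsIdealSimple.forall_exists_neg_or_zerosumfree {S : Type u} [Semiring S]
    (hS : IsIdealSimple S) : (∀ a : S, ∃ b, b + a = 0) ∨ ∀ a b : S, b + a = 0 → a = 0 := by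
  let V : Ideal S :=
    { carrier := {a | ∃ b, b + a = 0}
      zero_mem' := ⟨0, add_zero 0⟩
      add_mem' := fun {a a'} ⟨b, hb⟩ ⟨b', hb'⟩ =>
        ⟨b + b', by rw [add_add_add_comm, hb, hb', add_zero]⟩
      smul_mem' := fun s a ⟨b, hb⟩ => ⟨s * b, by rw [smul_eq_mul, ← mul_add, hb, mul_zero]⟩ }
  have hV : V.IsTwoSided := ⟨fun {a} s ⟨b, hb⟩ => ⟨b * s, by rw [← add_mul, hb, zero_mul]⟩⟩
  rcases hS V hV with h | h
  · refine .inr fun a b hab => ?_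
    have : a ∈ V := ⟨b, hab⟩
    rwa [h, Ideal.mem_bot] at this
  · refine .inl fun a => ?_
    have : a ∈ V := h ▸ trivial
    exact this

/-- Relate two elements when each is a summand of a multiple of the other. Then 1 + 1 is related to
1, so the associated idempotent satisfies e + e = e; zerosumfreeness keeps 1 unrelated to 0, so e ≠
0. The additively idempotent elements thus form a nonzero two-sided ideal. -/
theorem IsIdealSimple.add_self_of_zerosumfree {S : Type u} [Semiring S] [Nontrivial S]
    (hS : IsIdealSimple S) (hCP : IsRightCP S) (hz : ∀ a b : S, b + a = 0 → a = 0) (a : S) :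
    a + a = a := by
  obtain ⟨e, he, hc⟩ := isRightCP_iff.1 hCP
    { r := fun a b => (∃ (n : ℕ) (x : S), n • a = b + x) ∧ ∃ (n : ℕ) (x : S), n • b = a + x
      iseqv :=
        { refl := fun a => ⟨⟨1, 0, by simp⟩, 1, 0, by simp⟩
          symm := fun h => ⟨h.2, h.1⟩
          trans := by
            have aux : ∀ a b d : S, (∃ (n : ℕ) (x : S), n • a = b + x) →
                (∃ (n : ℕ) (x : S), n • b = d + x) → ∃ (n : ℕ) (x : S), n • a = d + x := by
              rintro a b d ⟨n, x, hx⟩ ⟨m, y, hy⟩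
              exact ⟨m * n, y + m • x, by rw [mul_nsmul', hx, nsmul_add, hy, add_assoc]⟩
            exact fun {_ _ _} h h' => ⟨aux _ _ _ h.1 h'.1, aux _ _ _ h'.2 h.2⟩ }
      add' := by
        have aux : ∀ a b a' b' : S, (∃ (n : ℕ) (x : S), n • a = b + x) →
            (∃ (n : ℕ) (x : S), n • a' = b' + x) →
              ∃ (n : ℕ) (x : S), n • (a + a') = b + b' + x := by
          rintro a b a' b' ⟨n, x, hx⟩ ⟨m, y, hy⟩
          refine ⟨n + m, x + y + (m • a + n • a'), ?_⟩
          rw [nsmul_add, add_nsmul, add_nsmul, hx, hy]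
          abel
        exact fun {_ _ _ _} h h' => ⟨aux _ _ _ _ h.1 h'.1, aux _ _ _ _ h.2 h'.2⟩ }
    (by
      have aux : ∀ a b s : S, (∃ (n : ℕ) (x : S), n • a = b + x) →
          ∃ (n : ℕ) (x : S), n • (a * s) = b * s + x := by
        rintro a b s ⟨n, x, hx⟩
        exact ⟨n, x * s, by rw [← smul_mul_assoc, hx, add_mul]⟩
      exact fun a b s h => ⟨aux a b s h.1, aux b a s h.2⟩)
  have hee : e + e = e := by
    have := (hc (1 + 1) 1).1 ⟨⟨1, 1, by simp⟩, 2, 0, by rw [two_nsmul, add_zero]⟩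
    rwa [mul_add, mul_one] at this
  have he0 : e ≠ 0 := by
    rintro rfl
    obtain ⟨⟨n, x, hx⟩, -⟩ := (hc 0 1).2 (by simp)
    rw [nsmul_zero, add_comm] at hx
    exact one_ne_zero (hz 1 x hx.symm)
  let I : Ideal S :=
    { carrier := {a | a + a = a}
      zero_mem' := add_zero 0
      add_mem' := fun {a b} (ha : a + a = a) (hb : b + b = b) => by
        change a + b + (a + b) = a + b
        rw [add_add_add_comm, ha, hb]
      smul_mem' := fun s a (ha : a + a = a) => by
        change s * a + s * a = s * a
        rw [← mul_add, ha] }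
  have hI : I.IsTwoSided := ⟨fun {a} s (ha : a + a = a) => by
    change a * s + a * s = a * s
    rw [← add_mul, ha]⟩
  rcases hS I hI with h | h
  · have : e ∈ I := hee
    rw [h, Ideal.mem_bot] at this
    exact absurd this he0
  · have : a ∈ I := h ▸ trivial
    exact this

/-- A nontrivial additively idempotent right CP-semiring contains an idempotent `e` such that
`e * S * e` is the two-element semiring. -/
theorem IsRightCP.exists_primitive_idempotent {S : Type u} [Semiring S] [Nontrivial S]
    (hCP : IsRightCP S) (hadd : ∀ a : S, a + a = a) :
    ∃ e : S, e * e = e ∧ e ≠ 0 ∧ ∀ s, e * s * e = 0 ∨ e * s * e = e := by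
  have hz : ∀ a b : S, a + b = 0 ↔ a = 0 ∧ b = 0 := fun a b => by
    refine ⟨fun h => ?_, fun h => by rw [h.1, h.2, add_zero]⟩
    have ha : a = 0 := by
      have : a + (a + b) = a + b := by rw [← add_assoc, hadd]
      rwa [h, add_zero] at this
    exact ⟨ha, by rwa [ha, zero_add] at h⟩
  -- These are proper right ideals closed under taking summands. The annihilators of nonzero
  -- elements belong to this family, which is why maximality is useful.
  let F : Set (Set S) := {I | 0 ∈ I ∧ (∀ a b, a + b ∈ I ↔ a ∈ I ∧ b ∈ I) ∧
    (∀ a s, a ∈ I → a * s ∈ I) ∧ (1 : S) ∉ I}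
  obtain ⟨I, ⟨hI0, hIadd, hImul, hI1⟩, hmax⟩ := zorn_subset F fun C hC hchain => by
    rcases C.eq_empty_or_nonempty with rfl | ⟨J, hJ⟩
    · refine ⟨{0}, ⟨rfl, hz, fun a s ha => ?_, one_ne_zero⟩, by simp⟩
      rw [Set.mem_singleton_iff] at ha ⊢
      rw [ha, zero_mul]
    · refine ⟨⋃₀ C, ⟨⟨J, hJ, (hC hJ).1⟩, fun a b => ⟨?_, ?_⟩, ?_, ?_⟩,
        fun K hK => Set.subset_sUnion_of_mem hK⟩
      · rintro ⟨K, hK, hab⟩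
        have := ((hC hK).2.1 a b).1 hab
        exact ⟨⟨K, hK, this.1⟩, K, hK, this.2⟩
      · rintro ⟨⟨K, hK, ha⟩, K', hK', hb⟩
        rcases hchain.total hK hK' with h | h
        · exact ⟨K', hK', ((hC hK').2.1 a b).2 ⟨h ha, hb⟩⟩
        · exact ⟨K, hK, ((hC hK).2.1 a b).2 ⟨ha, h hb⟩⟩
      · rintro a s ⟨K, hK, ha⟩
        exact ⟨K, hK, (hC hK).2.2.1 a s ha⟩
      · rintro ⟨K, hK, h1⟩
        exact (hC hK).2.2.2 h1
  obtain ⟨e, he, hc⟩ := isRightCP_iff.1 hCP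
    { r := fun a b => ∀ s, a * s ∈ I ↔ b * s ∈ I
      iseqv := ⟨fun a s => Iff.rfl, fun h s => (h s).symm, fun h h' s => (h s).trans (h' s)⟩
      add' := fun {w x y z} h h' s => by
        rw [add_mul, add_mul, hIadd, hIadd, h s, h' s] }
    fun a b s h t => by
      rw [mul_assoc, mul_assoc]
      exact h (s * t)
  have hc' : ∀ a b, (∀ s, a * s ∈ I ↔ b * s ∈ I) ↔ e * a = e * b := hc
  have heI : ∀ a, e * a = 0 ↔ a ∈ I := fun a => by
    constructor
    · intro h
      have := (hc' a 0).2 (by rw [h, mul_zero]) 1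
      rw [mul_one, zero_mul] at this
      exact this.2 hI0
    · intro h
      have := (hc' a 0).1 fun s => by
        rw [zero_mul]
        exact iff_of_true (hImul a s h) hI0
      rwa [mul_zero] at this
  refine ⟨e, he, fun h => hI1 ((heI 1).1 (by rw [h, zero_mul])), fun s => ?_⟩
  refine or_iff_not_imp_left.2 fun ha => ?_
  have hea : e * (e * s * e) = e * s * e := by rw [mul_assoc e s, ← mul_assoc e e, he]
  -- The right annihilator of a nonzero ese contains that of `e`, which is `I`, so by maximality
  -- they coincide.
  have hJ : {x | e * s * e * x = 0} ⊆ I :=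
    hmax ⟨mul_zero _, fun a b => by simp only [Set.mem_ofPred_eq, mul_add, hz],
      fun a t h => by
        rw [Set.mem_ofPred_eq] at h ⊢
        rw [← mul_assoc, h, zero_mul],
      fun h => ha (by rwa [Set.mem_ofPred_eq, mul_one] at h)⟩
    fun x hx => by rw [Set.mem_ofPred_eq, mul_assoc _ e x, (heI x).2 hx, mul_zero]
  have haI : ∀ x, e * s * e * x = 0 ↔ x ∈ I := fun x =>
    ⟨fun h => hJ h, fun hx => by rw [mul_assoc _ e x, (heI x).2 hx, mul_zero]⟩
  -- With equal annihilators, ese and `e` are related by the congruence, and left multiplication by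
  -- `e` identifies them.
  rw [← hea]
  conv_rhs => rw [← he]
  refine (hc' _ _).1 fun t => ?_
  rw [← heI, ← heI, ← mul_assoc e (e * s * e), ← mul_assoc e e, hea, he, haI, heI]

/-- Ideal-simplicity writes 1 as a finite sum of terms c_b e b. On Se the product e b x is 0 or e,
so x ↦ (e b x ≠ 0) are the characters and c_b e the matching elements. The same expansion shows that
S acts faithfully on Se, and that an additive endomorphism f is multiplication by the sum of the
f(c_b e) e b. -/
theorem IsIdealSimple.exists_ringEquiv_end {S : Type u} [Semiring S] (hS : IsIdealSimple S)
    (hz : ∀ a b : S, b + a = 0 → a = 0) {e : S} (he : e * e = e) (he0 : e ≠ 0)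
    (hee : ∀ s, e * s * e = 0 ∨ e * s * e = e) :
    ∃ (A : Type u) (_ : AddCommMonoid A),
      HasPrimeDecomposition A ∧ Nonempty (S ≃+* AddMonoid.End A) := by
  classical
  let I : Ideal S := Ideal.span (Set.range fun b => e * b)
  have hI : I.IsTwoSided := ⟨fun {a} s ha => by
    induction ha using Submodule.span_induction with
    | mem x hx =>
      obtain ⟨b, rfl⟩ := hx
      exact Ideal.subset_span ⟨b * s, (mul_assoc e b s).symm⟩
    | zero => simp
    | add x y _ _ hx hy => rw [add_mul]; exact I.add_mem hx hy
    | smul r x _ hx => rw [smul_eq_mul, mul_assoc]; exact I.mul_mem_left r hx⟩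
  have hI1 : (1 : S) ∈ I := by
    rcases hS I hI with h | h
    · have : e * 1 ∈ I := Ideal.subset_span ⟨1, rfl⟩
      rw [h, Ideal.mem_bot, mul_one] at this
      exact absurd this he0
    · exact h ▸ trivial
  obtain ⟨c, hc⟩ := Finsupp.mem_span_range_iff_exists_finsupp.1 hI1
  have hone : ∑ b : c.support, c b * (e * b) = 1 :=
    (Finset.sum_coe_sort c.support fun a => c a * (e * a)).trans hc
  let N : Submodule S S :=
    { carrier := {x | x * e = x}
      zero_mem' := zero_mul e
      add_mem' := fun {x y} (hx : x * e = x) (hy : y * e = y) => by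
        change (x + y) * e = x + y
        rw [add_mul, hx, hy]
      smul_mem' := fun s x (hx : x * e = x) => by
        change s * x * e = s * x
        rw [mul_assoc, hx] }
  have hN : ∀ x : N, x.1 * e = x.1 := fun x => x.2
  have hm : ∀ b, c b * e ∈ N := fun b => by
    change c b * e * e = c b * e
    rw [mul_assoc, he]
  have hp : ∀ b (x : N), e * b * x ≠ 0 → e * b * x = e := fun b x h => by
    have := hee (b * x)
    rw [mul_assoc e, mul_assoc b, hN, ← mul_assoc] at this
    exact this.resolve_left h
  have hsum : ∀ x : N, x = ∑ b : c.support, if e * b * x.1 ≠ 0 then ⟨c b * e, hm b⟩ else 0 := by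
    intro x
    apply Subtype.ext
    conv_lhs => rw [← one_mul x.1, ← hone, Finset.sum_mul]
    rw [Submodule.coe_sum]
    refine Finset.sum_congr rfl fun b _ => ?_
    rw [mul_assoc]
    split_ifs with h
    · rw [hp b x h]
    · rw [not_not.1 h, mul_zero]; rfl
  refine ⟨N, inferInstance, .of_fintype (ι := c.support) (fun b x => e * b * x.1 ≠ 0)
    (fun b => ⟨c b * e, hm b⟩) (fun b => by simp) (fun b x y => ?_) fun x => by convert hsum x,
    ⟨RingEquiv.ofBijective (Module.toAddMonoidEnd S N) ⟨fun s t hst => ?_, fun f => ?_⟩⟩⟩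
  · rw [Submodule.coe_add, mul_add, ← not_and_or, not_iff_not]
    refine ⟨fun h => ⟨hz _ (e * b * y) (by rwa [add_comm]), hz _ _ h⟩, fun h => ?_⟩
    rw [h.1, h.2, add_zero]
  · have hst' : ∀ x : N, s * x.1 = t * x.1 := fun x =>
      congrArg Subtype.val (DFunLike.congr_fun hst x)
    rw [← mul_one s, ← mul_one t, ← hone, Finset.mul_sum, Finset.mul_sum]
    refine Finset.sum_congr rfl fun b _ => ?_
    simpa only [mul_assoc] using congrArg (· * b.1) (hst' ⟨_, hm b⟩)
  · refine ⟨∑ b : c.support, (f ⟨c b * e, hm b⟩).1 * (e * b), ?_⟩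
    ext x
    change (∑ b : c.support, (f ⟨c b * e, hm b⟩).1 * (e * b)) * x.1 = (f x).1
    conv_rhs => rw [hsum x, map_sum, Submodule.coe_sum]
    rw [Finset.sum_mul]
    refine Finset.sum_congr rfl fun b _ => ?_
    rw [mul_assoc]
    split_ifs with h
    · rw [hp b x h, hN]
    · rw [not_not.1 h, mul_zero, map_zero]; rfl

/-! ### Passage to lattices and the equivalences -/

/-- The endomorphism semirings of isomorphic commutative monoids are isomorphic. -/
def AddEquiv.endRingEquiv {A B : Type*} [AddCommMonoid A] [AddCommMonoid B] (φ : A ≃+ B) :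
    AddMonoid.End A ≃+* AddMonoid.End B :=
  { toFun := fun f => φ.toAddMonoidHom.comp (f.comp φ.symm.toAddMonoidHom)
    invFun := fun f => φ.symm.toAddMonoidHom.comp (f.comp φ.toAddMonoidHom)
    left_inv := fun f => AddMonoidHom.ext fun x => by
      change φ.symm (φ (f (φ.symm (φ x)))) = f x
      simp
    right_inv := fun f => AddMonoidHom.ext fun x => by
      change φ (φ.symm (f (φ (φ.symm x)))) = f x
      simp
    map_mul' := fun f g => AddMonoidHom.ext fun x => by
      change φ (f (g (φ.symm x))) = φ (f (φ.symm (φ (g (φ.symm x)))))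
      simp
    map_add' := fun f g => AddMonoidHom.ext fun x => map_add φ _ _ }

theorem HasPrimeDecomposition.exists_endLattice {A : Type u} [AddCommMonoid A]
    (h : HasPrimeDecomposition A) :
    ∃ (M : Type u) (_ : DistribLattice M) (_ : OrderBot M),
      Finite M ∧ Nonempty (AddMonoid.End A ≃+* EndLattice M) := by
  obtain ⟨L, hL⟩ := h.exists_distribLattice
  let _ : OrderBot A := { bot := 0, bot_le := fun x => sup_eq_right.1 ((hL 0 x).trans (zero_add x)) }
  let φ : A ≃+ JoinMonoid A :=
    { Equiv.refl A with map_add' := fun x y => (hL x y).symm }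
  exact ⟨A, L, inferInstance, h.finite, ⟨φ.endRingEquiv⟩⟩

theorem hasPrimeDecomposition_joinMonoid (M : Type u) [L : DistribLattice M] [OrderBot M]
    [Finite M] : HasPrimeDecomposition (JoinMonoid M) := by
  have : Finite (JoinMonoid M) := ‹Finite M›
  exact .of_distribLattice (A := JoinMonoid M) L fun _ _ => rfl

theorem isRightCP_endLattice_iff (M : Type u) [DistribLattice M] [OrderBot M] [Finite M] :
    IsRightCP (EndLattice M) ↔ QuotientsDistributive M := by
  have : Finite (JoinMonoid M) := ‹Finite M›
  rw [(hasPrimeDecomposition_joinMonoid M).isRightCP_end_iff]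
  refine forall_congr' fun θ => ?_
  have : Finite θ.Quotient := Quotient.finite _
  exact hasPrimeDecomposition_iff_exists_distribLattice

theorem quotientsDistributive_iff_intervalCondition (M : Type u) [Lattice M] [OrderBot M]
    [Finite M] : QuotientsDistributive M ↔ IntervalCondition M :=
  ⟨fun h => h.incomparablePairsIsolated.intervalCondition,
    fun h => h.incomparablePairsIsolated.quotientsDistributive⟩

theorem theorem5p11 (S : Type u) [Semiring S] :
    List.TFAE [
      IsIdealSimple S ∧ IsRightCP S,
      IsSimpleSemiring S ∧ IsRightCP S,
      IsMatrixOverDivisionRing S ∨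
        ∃ (M : Type u) (_ : DistribLattice M) (_ : OrderBot M),
          Finite M ∧ IsRightCP (EndLattice M) ∧ Nonempty (S ≃+* EndLattice M),
      IsMatrixOverDivisionRing S ∨
        ∃ (M : Type u) (_ : DistribLattice M) (_ : OrderBot M),
          Finite M ∧ QuotientsDistributive M ∧ Nonempty (S ≃+* EndLattice M),
      IsMatrixOverDivisionRing S ∨
        ∃ (M : Type u) (_ : DistribLattice M) (_ : OrderBot M),
          Finite M ∧ IntervalCondition M ∧ Nonempty (S ≃+* EndLattice M)] := by
  tfae_have 1 → 3 := by
    rintro ⟨hS, hCP⟩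
    have of_end : ∀ (A : Type u) [AddCommMonoid A], HasPrimeDecomposition A →
        S ≃+* AddMonoid.End A → ∃ (M : Type u) (_ : DistribLattice M) (_ : OrderBot M),
          Finite M ∧ IsRightCP (EndLattice M) ∧ Nonempty (S ≃+* EndLattice M) := by
      intro A _ hA φ
      obtain ⟨M, _, _, hM, ⟨ψ⟩⟩ := hA.exists_endLattice
      exact ⟨M, _, _, hM, hCP.of_ringEquiv (φ.trans ψ).symm, ⟨φ.trans ψ⟩⟩
    cases subsingleton_or_nontrivial S
    -- The zero semiring is the endomorphism semiring of the one-point lattice, whose prime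
    -- decomposition is empty.
    · refine .inr (of_end PUnit.{u + 1} ⟨0, nofun, nofun, nofun, nofun, fun _ => rfl⟩
        (RingEquiv.ofBijective (Module.toAddMonoidEnd S PUnit.{u + 1})
          ⟨Function.injective_of_subsingleton _, fun f => ⟨0, AddMonoidHom.ext fun _ => rfl⟩⟩))
    · rcases hS.forall_exists_neg_or_zerosumfree with hneg | hz
      · exact .inl (isMatrixOverDivisionRing_of_neg hS hCP hneg)
      · have hadd := hS.add_self_of_zerosumfree hCP hz
        obtain ⟨e, he, he0, hee⟩ := hCP.exists_primitive_idempotent hadd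
        obtain ⟨A, _, hA, ⟨φ⟩⟩ := hS.exists_ringEquiv_end hz he he0 hee
        exact .inr (of_end A hA φ)
  tfae_have 3 → 2 := by
    rintro (h | ⟨M, _, _, _, hCP, ⟨φ⟩⟩)
    · exact h.isSimpleSemiring_and_isRightCP
    · have hM := hasPrimeDecomposition_joinMonoid M
      exact ⟨⟨hM.isCongruenceSimple_end.of_ringEquiv φ, hM.isIdealSimple_end.of_ringEquiv φ⟩,
        hCP.of_ringEquiv φ⟩
  tfae_have 2 → 1 := fun h => ⟨h.1.2, h.2⟩
  tfae_have 3 ↔ 4 := by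
    refine or_congr_right (exists_congr fun M => exists_congr fun _ => exists_congr fun _ =>
      and_congr_right fun _ => ?_)
    rw [isRightCP_endLattice_iff]
  tfae_have 4 ↔ 5 := by
    refine or_congr_right (exists_congr fun M => exists_congr fun _ => exists_congr fun _ =>
      and_congr_right fun _ => ?_)
    rw [quotientsDistributive_iff_intervalCondition]
  tfae_finish
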